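/- **Theorem 1.5.** Let $K$ be a field of characteristic zero, let $\{x_{i,j}\}_{i,j\in\mathbb Z}$ be indeterminates, and let $\Bbbk=K(x_{i,j})$. Let $\uparrow$ be the $K$-automorphism of $\Bbbk$ with $\uparrow x_{i,j}=x_{i+1,j}$. For a finite multiset of integers $S=\{i_1\le i_2\le\dots\le i_m\}$ put $x_S=x_{1,i_1}x_{2,i_2}\cdots x_{m,i_m}$ and $X_S=x_S^2$; for finite multisets $S,T$ put $$z(S,T)=\frac{1}{\uparrow X_S}\sum_{j\in T}X_{S\cup j},$$ where $S\cup j$ is the multiset union (so the multiplicity of $j$ in $S\cup j$ is one more than in $S$). Let $\Sigma$ be a simplicial complex (with $\emptyset\in\Sigma$) of dimension $d\ge 0$ on the vertex set $[p,q]=\{p,p+1,\dots,q\}\subset\mathbb Z$ which is *shifted*: whenever $a<b$ are in $[p,q]$ and $F\in\Sigma$ is a face with $a\notin F$, $b\in F$, then $F\setminus\{b\}\cup\{a\}\in\Sigma$. (Not every element of $[p,q]$ need be a face of $\Sigma$.) For $-1\le k\le d$ let $\Sigma_k$ be the set of $k$-dimensional faces (those with $k+1$ elements) and $C_k(\Sigma)$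 the $\Bbbk$-vector space with basis $\{[F]: F\in\Sigma_k\}$. Put $\varepsilon(v,F)=(-1)^{r+1}$ if $v$ is the $r$-th smallest element of $F$. For $0\le i\le d$ define the algebraic finely weighted boundary map $\partial_i:C_i(\Sigma)\to C_{i-1}(\Sigma)$ and coboundary map $\partial_i^*:C_{i-1}(\Sigma)\to C_i(\Sigma)$ by $$\partial_i[F]=\sum_{j\in F}\varepsilon(j,F)\,\frac{\uparrow^{d-i}x_F}{\uparrow^{d-i+1}x_{F\setminus j}}\,[F\setminus j],\qquad \partial_i^*[G]=\sum_{\substack{j\in[p,q]\setminus G\\ G\cup j\in\Sigma}}\varepsilon(j,G\cup j)\,\frac{\uparrow^{d-i}x_{G\cup j}}{\uparrow^{d-i+1}x_{G}}\,[G\cup j],$$ and the algebraic finely weighted up-down Laplacian $\mathbf L^{\rm ud}_{\Sigma,i-1}=\partial_i\partial_i^*$, an endomorphism of $C_{i-1}(\Sigma)$. A *critical pair* of $\Sigma_i$ is a pair $(A,B)$ of $(i+1)$-element sets of integers with $A=\{a_1<\dots<a_{i+1}\}\in\Sigma_i$, $B\notin\Sigma_i$, and $B=\{a_1,\dots,a_{r-1},a_r+1,a_{r+1},\dots,a_{i+1}\}$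 for some $r$ ($B$ need not be contained in $[p,q]$). Its *long signature* is $(S,T)$ with $S=\{a_1,\dots,a_{r-1}\}$ and $T=[p,a_r]$. Then, for every $0\le i\le d$, all eigenvalues of $\mathbf L^{\rm ud}_{\Sigma,i-1}$ lie in $\Bbbk$ (its characteristic polynomial splits over $\Bbbk$), and the multiset of its nonzero eigenvalues, counted with multiplicity as roots of the characteristic polynomial, equals the multiset $$\bigl\{\uparrow^{d-i}z(S,T)\bigr\},$$ where $(S,T)$ is the long signature of $(A,B)$ and $(A,B)$ runs over all critical pairs of $\Sigma_i$ (one element of the multiset for each critical pair). -/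

import Mathlib

namespace ShiftedSpectrum

noncomputable section

/-! ## Simplicial complexes on a finite set of integers -/

/-- A simplicial complex on the vertex set `V`: a family of subsets of `V` that contains the empty
set and is closed under taking subsets. -/
structure SimplicialComplexOn (V : Finset ℤ) where
  faces : Finset (Finset ℤ)
  subset_vertices : ∀ F ∈ faces, F ⊆ V
  empty_mem : ∅ ∈ faces
  down_closed : ∀ F ∈ faces, ∀ G, G ⊆ F → G ∈ faces

namespace SimplicialComplexOn

variable {V : Finset ℤ}

/-- The dimension of a complex: the maximum of `dim F = |F| - 1` over its faces `F`. -/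
def dim (Δ : SimplicialComplexOn V) : ℤ := (Δ.faces.sup Finset.card : ℕ) - 1

/-- The family of all `i`-dimensional faces, `i ≥ -1` (for `i = -1` it is `{∅}`). -/
def facesOfDim (Δ : SimplicialComplexOn V) (i : ℤ) : Finset (Finset ℤ) :=
  Δ.faces.filter fun F => (F.card : ℤ) = i + 1

/-- A complex is shifted if in every face, every vertex can be replaced by any smaller vertex
that is not yet in the face. -/
def IsShifted (Δ : SimplicialComplexOn V) : Prop :=
  ∀ i ∈ V, ∀ j ∈ V, i < j → ∀ F ∈ Δ.faces, i ∉ F → j ∈ F → insert i (F.erase j) ∈ Δ.faces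

theorem mem_facesOfDim {Δ : SimplicialComplexOn V} {i : ℤ} {F : Finset ℤ} :
    F ∈ Δ.facesOfDim i ↔ F ∈ Δ.faces ∧ (F.card : ℤ) = i + 1 := by
  simp [facesOfDim]

theorem erase_mem_facesOfDim {Δ : SimplicialComplexOn V} {i : ℤ} {F : Finset ℤ} {j : ℤ}
    (hF : F ∈ Δ.facesOfDim (i + 1)) (hj : j ∈ F) : F.erase j ∈ Δ.facesOfDim i := by
  rw [mem_facesOfDim] at hF ⊢
  refine ⟨Δ.down_closed F hF.1 _ (Finset.erase_subset j F), ?_⟩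
  have h := Finset.card_erase_add_one hj
  have h2 := hF.2
  omega

end SimplicialComplexOn

/-! ## Indeterminates, the raising operator, weights -/

/-- The field of rational functions over `K` in indeterminates indexed by pairs of integers. -/
abbrev RatFun (K : Type*) [Field K] : Type _ := FractionRing (MvPolynomial (ℤ × ℤ) K)

/-- The indeterminate `x_{i,j}`. -/
def x (K : Type*) [Field K] (i j : ℤ) : RatFun K :=
  algebraMap (MvPolynomial (ℤ × ℤ) K) (RatFun K) (MvPolynomial.X (i, j))

/-- The raising operator `↑`: the `K`-automorphism of the field of rational functions that sends
`x_{i,j}` to `x_{i+1,j}`. Its integer powers are taken in the automorphism group. -/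
def raise (K : Type*) [Field K] : RatFun K ≃ₐ[K] RatFun K :=
  IsFractionRing.algEquivOfAlgEquiv
    (MvPolynomial.renameEquiv K ((Equiv.addRight (1 : ℤ)).prodCongr (Equiv.refl ℤ)))

theorem raise_x (K : Type*) [Field K] (i j : ℤ) : raise K (x K i j) = x K (i + 1) j := by
  simp [raise, x]

/-- The monomial `x_S = x_{1,i_1} x_{2,i_2} ⋯ x_{m,i_m}` of a multiset of integers
`S = {i_1 ≤ i_2 ≤ ⋯ ≤ i_m}`. -/
def xMon (K : Type*) [Field K] (S : Multiset ℤ) : RatFun K :=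
  ((S.sort (· ≤ ·)).mapIdx fun k v => x K (k + 1) v).prod

/-- `X_S = x_S ^ 2`. -/
def XMon (K : Type*) [Field K] (S : Multiset ℤ) : RatFun K := xMon K S ^ 2

/-- The `z`-polynomial `z(S,T) = (∑_{j ∈ T} X_{S ∪ j}) / ↑X_S`, the union being that of
multisets. -/
def zPoly (K : Type*) [Field K] (S T : Multiset ℤ) : RatFun K :=
  1 / raise K (XMon K S) * (T.map fun j => XMon K (S + {j})).sum

/-! ## Chains and the algebraic finely weighted Laplacian -/

/-- The sign `ε(v, F)`: it is `(-1)^(j+1)` if `v` is the `j`-th smallest element of `F`, and `0` if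
`v ∉ F`. -/
def eps (v : ℤ) (F : Finset ℤ) : ℤ :=
  if v ∈ F then (-1) ^ ((F.filter (· ≤ v)).card + 1) else 0

variable {V : Finset ℤ}

/-- The `i`-chains: the vector space with basis `[F]`, `F` an `i`-dimensional face. -/
abbrev Chain (K : Type*) [Field K] (Δ : SimplicialComplexOn V) (i : ℤ) : Type _ :=
  {F : Finset ℤ // F ∈ Δ.facesOfDim i} →₀ RatFun K

/-- The algebraic finely weighted boundary map from `(i+1)`-chains to `i`-chains. With `d = dim Δ`,
the coefficient of `[F \ j]` in the image of `[F]` is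
`ε(j, F) ↑^(d-(i+1)) x_F / ↑^(d-(i+1)+1) x_{F \ j}`. -/
def boundary (K : Type*) [Field K] (Δ : SimplicialComplexOn V) (i : ℤ) :
    Chain K Δ (i + 1) →ₗ[RatFun K] Chain K Δ i :=
  Finsupp.linearCombination (RatFun K) fun F =>
    ∑ j ∈ F.1.attach,
      Finsupp.single ⟨F.1.erase j.1, SimplicialComplexOn.erase_mem_facesOfDim F.2 j.2⟩
        ((eps j.1 F.1 : RatFun K) *
          ((raise K ^ (Δ.dim - (i + 1))) (xMon K F.1.val) /
            (raise K ^ (Δ.dim - (i + 1) + 1)) (xMon K (F.1.erase j.1).val)))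

/-- The algebraic finely weighted coboundary map from `i`-chains to `(i+1)`-chains. With
`d = dim Δ`, the coefficient of `[F ∪ j]` in the image of `[F]` is
`ε(j, F ∪ j) ↑^(d-i-1) x_{F ∪ j} / ↑^(d-i) x_F`, for those vertices `j ∉ F` for which `F ∪ j` is a
face. -/
def coboundary (K : Type*) [Field K] (Δ : SimplicialComplexOn V) (i : ℤ) :
    Chain K Δ i →ₗ[RatFun K] Chain K Δ (i + 1) :=
  Finsupp.linearCombination (RatFun K) fun F =>
    ∑ j ∈ V \ F.1,
      if h : insert j F.1 ∈ Δ.facesOfDim (i + 1) then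
        Finsupp.single ⟨insert j F.1, h⟩
          ((eps j (insert j F.1) : RatFun K) *
            ((raise K ^ (Δ.dim - i - 1)) (xMon K (insert j F.1).val) /
              (raise K ^ (Δ.dim - i)) (xMon K F.1.val)))
      else 0

/-- The algebraic finely weighted up-down Laplacian on `i`-chains. -/
def upDownLaplacian (K : Type*) [Field K] (Δ : SimplicialComplexOn V) (i : ℤ) :
    Module.End (RatFun K) (Chain K Δ i) :=
  boundary K Δ i ∘ₗ coboundary K Δ i

open Classical in
/-- The nonzero eigenvalues, lying in the ground field and counted with their multiplicities as
roots of the characteristic polynomial, of an endomorphism. -/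
def nonzeroEigenvalues {L M : Type*} [Field L] [AddCommGroup M] [Module L M]
    [Module.Finite L M] (f : Module.End L M) : Multiset L :=
  f.charpoly.roots.filter fun μ => μ ≠ 0

/-! ## Critical pairs and long signatures -/

/-- `B` covers `A = {a_1 < ⋯ < a_m}` in the componentwise order on `m`-sets of integers:
`B = {a_1, …, a_{i-1}, a_i + 1, a_{i+1}, …, a_m}` for some `i`, where `a_i + 1` is not itself in
`A`, so that `B` is again an `m`-set. -/
def Covers (A B : Finset ℤ) : Prop :=
  ∃ a ∈ A, a + 1 ∉ A ∧ B = insert (a + 1) (A.erase a)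

/-- `(A, B)` is a critical pair of the family `𝓕`. -/
def IsCriticalPair (𝓕 : Finset (Finset ℤ)) (P : Finset ℤ × Finset ℤ) : Prop :=
  P.1 ∈ 𝓕 ∧ P.2 ∉ 𝓕 ∧ Covers P.1 P.2

theorem finite_isCriticalPair (𝓕 : Finset (Finset ℤ)) : {P | IsCriticalPair 𝓕 P}.Finite := by
  refine Set.Finite.subset (Finset.finite_toSet
    (𝓕.biUnion fun A => A.image fun a => (A, insert (a + 1) (A.erase a)))) ?_
  rintro ⟨A, B⟩ ⟨hA, -, a, ha, -, hB⟩
  simp only [Finset.mem_coe, Finset.mem_biUnion, Finset.mem_image]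
  exact ⟨A, hA, a, ha, Prod.ext rfl hB.symm⟩

/-- The finite set of all critical pairs of a family. -/
def criticalPairs (𝓕 : Finset (Finset ℤ)) : Finset (Finset ℤ × Finset ℤ) :=
  (finite_isCriticalPair 𝓕).toFinset

/-- The long signature `(S, T)` of a critical pair `(A, B)`, where `p` is the initial vertex. If
`a_i` is the element of `A` that is raised, then `A \ B = {a_i}`, so that
`S = {v ∈ A | v < a_i} = {a_1, …, a_{i-1}}` and `T = [p, a_i]`. -/
def longSignature (p : ℤ) (P : Finset ℤ × Finset ℤ) : Finset ℤ × Finset ℤ :=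
  (P.1.filter fun v => ∀ a ∈ P.1 \ P.2, v < a, (P.1 \ P.2).biUnion fun a => Finset.Icc p a)

/-- The multiset of long signatures of the critical pairs of a family. -/
def longSignatures (p : ℤ) (𝓕 : Finset (Finset ℤ)) : Multiset (Finset ℤ × Finset ℤ) :=
  (criticalPairs 𝓕).val.map (longSignature p)

end

end ShiftedSpectrum

/-! In the bases of faces, coboundary and boundary are transposes Aᵀ and A, so the up-down Laplacian
A Aᵀ has the same nonzero spectrum as Aᵀ A, the matrix `gram`. This matrix makes sense for every
shifted family 𝓕 on [p, q] and all nonvanishing weights, and its spectrum is found by induction on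
the initial vertex p.

Split 𝓕 into the faces through p, indexed by the link, and the deletion. With c = w 0 p, the
weighted boundary is [[c, P], [-(c / w 1 p) N, 0]]: P is the boundary from the deletion to the link
(shiftedness puts every such ridge in the link), and N is the boundary of the link with raised
weights. The raised denominators make the corner scalar and give N P = 0. With r = (c / w 1 p)², the
Gram matrix is [[c² + r NᵀN, c P], [c Pᵀ, PᵀP]], and a conjugation
(`charpoly_fromBlocks_of_mul_eq_smul`) reduces it to c² + r NᵀN + P Pᵀ. The product of the last two
summands is zero, so their spectra merge (`X_pow_mul_charpoly_add_of_mul_eq_zero`). Up to zeros, the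
outcome is r times the spectrum of the link, the spectrum of the deletion, and k further zeros, all
shifted by c².

Critical pairs obey the same recursion (`critSigs_eq`), and so do the z-polynomials
(`sigEigenvalue_insert`, `sigEigenvalue_eq_add`). The k zeros match the pairs that raise p itself,
since z(∅, {p}) = c²; the count rests on `card_link_filter_notMem` and `card_critSigs`.
Characteristic zero makes all listed values nonzero. -/

namespace ShiftedSpectrum

/-! ### Characteristic polynomials of block matrices -/

section Charpoly

open Matrix Polynomial

variable {L m n : Type*} [Field L] [Fintype m] [DecidableEq m] [Fintype n] [DecidableEq n]

/-- Conjugation by the unipotent R = [[1, c⁻¹ P], [0, 1]] makes the matrix block triangular with a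
zero diagonal block; the upper right entry vanishes because A acts on the columns of P as c². -/
theorem charpoly_fromBlocks_of_mul_eq_smul {c : L} (hc : c ≠ 0) (A : Matrix m m L)
    (P : Matrix m n L) (hA : A * P = c ^ 2 • P) :
    (fromBlocks A (c • P) (c • Pᵀ) (Pᵀ * P)).charpoly =
      X ^ Fintype.card n * (A + P * Pᵀ).charpoly := by
  set R : Matrix (m ⊕ n) (m ⊕ n) L := fromBlocks 1 (c⁻¹ • P) 0 1 with hR
  set R' : Matrix (m ⊕ n) (m ⊕ n) L := fromBlocks 1 (-(c⁻¹ • P)) 0 1 with hR'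
  set Q : Matrix (m ⊕ n) (m ⊕ n) L := fromBlocks (A + P * Pᵀ) 0 (c • Pᵀ) 0 with hQ
  have hRR' : R * R' = 1 := by
    simp [hR, hR', fromBlocks_multiply, fromBlocks_one]
  have hR'R : R' * R = 1 := by
    simp [hR, hR', fromBlocks_multiply, fromBlocks_one]
  have key : fromBlocks A (c • P) (c • Pᵀ) (Pᵀ * P) = R' * (Q * R) := by
    have h : R * fromBlocks A (c • P) (c • Pᵀ) (Pᵀ * P) = Q * R := by
      rw [hR, hQ, fromBlocks_multiply, fromBlocks_multiply]
      congr 1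
      · simp [smul_smul, hc]
      · simp only [Matrix.one_mul, Matrix.mul_one, Matrix.add_mul, Matrix.smul_mul,
          Matrix.mul_smul, add_zero, hA, smul_smul, smul_add, Matrix.mul_assoc]
        congr 2
        field_simp
      · simp
      · simp [smul_smul, hc]
    rw [← h, ← Matrix.mul_assoc, hR'R, Matrix.one_mul]
  rw [key, charpoly_mul_comm, Matrix.mul_assoc, hRR', Matrix.mul_one, hQ,
    charpoly_fromBlocks_zero₁₂, charpoly_zero, mul_comm]

/-- Take determinants in (X - U)(X - V) = X (X - (U + V)). -/
theorem X_pow_mul_charpoly_add_of_mul_eq_zero (U V : Matrix n n L) (h : U * V = 0) :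
    X ^ Fintype.card n * (U + V).charpoly = U.charpoly * V.charpoly := by
  have hUV : charmatrix U * charmatrix V = (X : L[X]) • charmatrix (U + V) := by
    have h' : U.map (C : L →+* L[X]) * V.map (C : L →+* L[X]) = 0 := by
      rw [← Matrix.map_mul, h]; simp
    have hs : ∀ M : Matrix n n L, charmatrix M = (X : L[X]) • 1 - M.map (C : L →+* L[X]) := by
      intro M
      ext i j
      simp [charmatrix, Matrix.one_apply, Matrix.diagonal_apply]
    rw [hs, hs, hs, sub_mul, mul_sub, mul_sub, h', Matrix.map_add _ (by simp)]
    simp only [Matrix.smul_mul, Matrix.one_mul, Matrix.mul_smul, Matrix.mul_one, smul_sub, smul_add]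
    abel
  rw [charpoly, charpoly, charpoly, ← det_mul, hUV, det_smul]

theorem charpoly_smul_comp (r : L) (A : Matrix n n L) :
    (r • A).charpoly.comp (C r * X) = C (r ^ Fintype.card n) * A.charpoly := by
  have h : (compRingHom (C r * X)).mapMatrix (charmatrix (r • A)) = (C r : L[X]) • charmatrix A := by
    ext1 i j
    by_cases hij : i = j
    · subst hij
      simp [charmatrix_apply_eq, mul_sub]
    · simp [charmatrix_apply_ne _ _ _ hij]
  rw [charpoly, charpoly, ← coe_compRingHom_apply, RingHom.map_det, h, det_smul, C_pow]

/-- The monic polynomial with the given multiset of roots. -/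
noncomputable def rootProd (s : Multiset L) : L[X] := (s.map fun a => X - C a).prod

theorem rootProd_add (s t : Multiset L) : rootProd (s + t) = rootProd s * rootProd t := by
  simp [rootProd]

theorem rootProd_replicate (k : ℕ) (a : L) : rootProd (.replicate k a) = (X - C a) ^ k := by
  simp [rootProd]

theorem rootProd_comp_add (c : L) (s : Multiset L) :
    (rootProd s).comp (X - C c) = rootProd (s.map (· + c)) := by
  induction s using Multiset.induction with
  | empty => simp [rootProd]
  | cons a s ih =>
    simp only [rootProd, Multiset.map_cons, Multiset.prod_cons, mul_comp] at ih ⊢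
    rw [ih]
    simp [sub_sub, add_comm]

theorem rootProd_map_mul_comp (r : L) (s : Multiset L) :
    (rootProd (s.map (r * ·))).comp (C r * X) = C (r ^ s.card) * rootProd s := by
  induction s using Multiset.induction with
  | empty => simp [rootProd]
  | cons a s ih =>
    simp only [rootProd, Multiset.map_cons, Multiset.prod_cons, mul_comp, Multiset.card_cons]
      at ih ⊢
    rw [ih]
    rw [sub_comp, X_comp, C_comp, pow_succ, C_mul, C_mul]
    ring

theorem natDegree_rootProd (s : Multiset L) : (rootProd s).natDegree = s.card := by
  simp [rootProd, natDegree_multiset_prod_X_sub_C_eq_card]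

theorem charpoly_smul_eq_rootProd {r : L} (hr : r ≠ 0) {A : Matrix n n L} {s : Multiset L}
    (h : A.charpoly = rootProd s) : (r • A).charpoly = rootProd (s.map (r * ·)) := by
  have hcard : Fintype.card n = s.card := by
    rw [← natDegree_rootProd, ← h, charpoly_natDegree_eq_dim]
  have h1 : (r • A).charpoly.comp (C r * X) = (rootProd (s.map (r * ·))).comp (C r * X) := by
    rw [charpoly_smul_comp, rootProd_map_mul_comp, h, hcard]
  -- Substituting r⁻¹ X undoes the substitution of r X.
  have h2 := congrArg (fun f => f.comp (C r⁻¹ * X)) h1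
  simpa [comp_assoc, ← mul_assoc, ← C_mul, hr] using h2

theorem charpoly_smul_one_add (c : L) (A : Matrix n n L) :
    (c • (1 : Matrix n n L) + A).charpoly = A.charpoly.comp (X - C c) := by
  have := charpoly_sub_scalar A (-c)
  rw [sub_eq_add_neg, ← map_neg, neg_neg, C_neg, ← sub_eq_add_neg] at this
  rw [← this, add_comm, scalar_apply, ← smul_one_eq_diagonal]

theorem eq_of_X_pow_mul {k l m' : ℕ} {f g : L[X]} (h : X ^ k * f = X ^ l * g) (hl : l = k + m') :
    f = X ^ m' * g := by
  rw [hl, pow_add, mul_assoc] at h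
  exact mul_left_cancel₀ (pow_ne_zero _ X_ne_zero) h

/-- Spectrum of the Gram matrix of a block matrix `[[c, P], [-N, 0]]` with `N P = 0`, where
`A = Nᵀ N`. -/
theorem charpoly_gram_fromBlocks {c : L} (hc : c ≠ 0) (A : Matrix m m L)
    (P : Matrix m n L) (hA : A * P = 0) {s t : Multiset L} {l₀ d₀ k : ℕ}
    (hs : A.charpoly = X ^ l₀ * rootProd s) (ht : (Pᵀ * P).charpoly = X ^ d₀ * rootProd t)
    (hd : Fintype.card n = d₀ + t.card) (hl : l₀ = t.card + k) :
    (fromBlocks (c ^ 2 • 1 + A) (c • P) (c • Pᵀ) (Pᵀ * P)).charpoly =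
      X ^ Fintype.card n *
        rootProd ((s + t).map (· + c ^ 2) + .replicate k (c ^ 2)) := by
  rw [charpoly_fromBlocks_of_mul_eq_smul hc _ _ (by rw [Matrix.add_mul, hA]; simp), add_assoc,
    charpoly_smul_one_add]
  have h1 := X_pow_mul_charpoly_add_of_mul_eq_zero A (P * Pᵀ) (by rw [← Matrix.mul_assoc, hA]; simp)
  have h2 := charpoly_mul_comm' P Pᵀ
  have h3 : X ^ (Fintype.card m + Fintype.card n) * (A + P * Pᵀ).charpoly =
      X ^ (l₀ + d₀ + Fintype.card m) * rootProd (s + t) := by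
    calc _ = X ^ Fintype.card n * (X ^ Fintype.card m * (A + P * Pᵀ).charpoly) := by ring
      _ = A.charpoly * (X ^ Fintype.card n * (P * Pᵀ).charpoly) := by rw [h1]; ring
      _ = _ := by rw [h2, hs, ht, rootProd_add]; ring
  -- By `hd` and `hl`, exactly k factors X survive the cancellation; the shift by c² turns them into
  -- k roots c².
  have h4 := eq_of_X_pow_mul (m' := k) h3 (by omega)
  rw [h4, mul_comp, rootProd_comp_add, rootProd_add _ (.replicate _ _), rootProd_replicate]
  simp [mul_comm]

end Charpoly

/-! ### Weights, z-polynomials and weighted incidence numbers -/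

section Weights

variable {L : Type*} [Field L]

/-- The weights with the first index raised by one. -/
def up (w : ℕ → ℤ → L) : ℕ → ℤ → L := fun k => w (k + 1)

/-- The weight `w 0 i₁ * w 1 i₂ * ⋯` of a list. -/
def listWeight : (ℕ → ℤ → L) → List ℤ → L
  | _, [] => 1
  | w, v :: l => w 0 v * listWeight (up w) l

/-- The weight of a multiset, whose elements are listed in increasing order. -/
noncomputable def weight (w : ℕ → ℤ → L) (S : Multiset ℤ) : L :=
  listWeight w (S.sort (· ≤ ·))

/-- The `z`-polynomial with general weights. -/
noncomputable def zWeight (w : ℕ → ℤ → L) (S : Multiset ℤ) (T : Finset ℤ) : L :=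
  (∑ j ∈ T, weight w (j ::ₘ S) ^ 2) / weight (up w) S ^ 2

theorem up_ne_zero {w : ℕ → ℤ → L} (hw : ∀ k v, w k v ≠ 0) (k : ℕ) (v : ℤ) : up w k v ≠ 0 :=
  hw (k + 1) v

theorem listWeight_ne_zero {w : ℕ → ℤ → L} (hw : ∀ k v, w k v ≠ 0) (l : List ℤ) :
    listWeight w l ≠ 0 := by
  induction l generalizing w with
  | nil => simp [listWeight]
  | cons v l ih => exact mul_ne_zero (hw 0 v) (ih (up_ne_zero hw))

theorem weight_ne_zero {w : ℕ → ℤ → L} (hw : ∀ k v, w k v ≠ 0) (S : Multiset ℤ) :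
    weight w S ≠ 0 :=
  listWeight_ne_zero hw _

theorem weight_cons (w : ℕ → ℤ → L) {p : ℤ} {S : Multiset ℤ} (h : ∀ v ∈ S, p ≤ v) :
    weight w (p ::ₘ S) = w 0 p * weight (up w) S := by
  rw [weight, Multiset.sort_cons p S _ h, listWeight, weight]

theorem weight_insert (w : ℕ → ℤ → L) {p : ℤ} {S : Finset ℤ} (h : ∀ v ∈ S, p < v) :
    weight w (insert p S).val = w 0 p * weight (up w) S.val := by
  rw [Finset.insert_val_of_notMem fun hp => (h p hp).false, weight_cons w fun v hv => (h v hv).le]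

/-- As p comes first in the sorted multiset, the summand j = p is (w 0 p)² times the denominator. -/
theorem zWeight_insert_right {w : ℕ → ℤ → L} (hw : ∀ k v, w k v ≠ 0) {p : ℤ} {S : Multiset ℤ}
    {T : Finset ℤ} (hp : p ∉ T) (h : ∀ v ∈ S, p ≤ v) :
    zWeight w S (insert p T) = zWeight w S T + w 0 p ^ 2 := by
  have := weight_ne_zero (up_ne_zero hw) S
  rw [zWeight, Finset.sum_insert hp, weight_cons w h, zWeight]
  field_simp
  ring

/-- The element p stays first in every multiset that occurs, so it splits off from each numerator
term as w 0 p and from the raised denominator as w 1 p, both squared. -/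
theorem zWeight_cons_left {w : ℕ → ℤ → L} (hw : ∀ k v, w k v ≠ 0) {p : ℤ} {S : Multiset ℤ}
    {T : Finset ℤ} (hT : ∀ v ∈ T, p ≤ v) (h : ∀ v ∈ S, p ≤ v) :
    zWeight w (p ::ₘ S) T = (w 0 p / w 1 p) ^ 2 * zWeight (up w) S T := by
  have h1 : ∀ j ∈ T, weight w (j ::ₘ p ::ₘ S) ^ 2 = w 0 p ^ 2 * weight (up w) (j ::ₘ S) ^ 2 := by
    intro j hj
    rw [Multiset.cons_swap, weight_cons w, mul_pow]
    intro v hv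
    rcases Multiset.mem_cons.1 hv with rfl | hv
    · exact hT _ hj
    · exact h v hv
  rw [zWeight, Finset.sum_congr rfl h1, ← Finset.mul_sum, weight_cons _ h, zWeight,
    show up w 0 p = w 1 p from rfl]
  have := weight_ne_zero (up_ne_zero (up_ne_zero hw)) S
  have := hw 1 p
  field_simp

theorem zWeight_zero_singleton {w : ℕ → ℤ → L} (hw : ∀ k v, w k v ≠ 0) (p : ℤ) :
    zWeight w 0 {p} = w 0 p ^ 2 := by
  rw [← insert_empty_eq, zWeight_insert_right hw (by simp) (by simp)]
  simp [zWeight]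

/-- The incidence number of `G` and `F`: the coefficient of `G` in the boundary of `F`. -/
noncomputable def incidence (L : Type*) [Field L] (G F : Finset ℤ) : L :=
  ∑ j ∈ F, if F.erase j = G then (eps j F : L) else 0

theorem exists_of_incidence_ne_zero {G F : Finset ℤ} (h : incidence L G F ≠ 0) :
    ∃ j ∈ F, F.erase j = G := by
  obtain ⟨j, hj, hne⟩ := Finset.exists_ne_zero_of_sum_ne_zero h
  exact ⟨j, hj, by_contra fun h' => hne (if_neg h')⟩

theorem eps_insert_self {p : ℤ} {G : Finset ℤ} (h : ∀ v ∈ G, p < v) : eps p (insert p G) = 1 := by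
  have : (insert p G).filter (· ≤ p) = {p} := by
    ext v
    simp only [Finset.mem_filter, Finset.mem_insert, Finset.mem_singleton]
    constructor
    · rintro ⟨rfl | hv, hvp⟩
      · rfl
      · exact absurd (h v hv) hvp.not_gt
    · rintro rfl
      simp
  simp [eps, this]

theorem eps_insert_of_mem {p j : ℤ} {G : Finset ℤ} (h : ∀ v ∈ G, p < v) (hj : j ∈ G) :
    eps j (insert p G) = -eps j G := by
  have hp : p ∉ G.filter (· ≤ j) := fun hp => (h p (Finset.mem_filter.1 hp).1).false
  rw [eps, eps, if_pos (Finset.mem_insert_of_mem hj), if_pos hj, Finset.filter_insert,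
    if_pos (h j hj).le, Finset.card_insert_of_notMem hp, pow_succ]
  ring

theorem incidence_insert_right {p : ℤ} {H G : Finset ℤ} (hH : p ∉ H) (hG : ∀ v ∈ G, p < v) :
    incidence L H (insert p G) = if H = G then 1 else 0 := by
  have hp : p ∉ G := fun hp => (hG p hp).false
  rw [incidence, Finset.sum_insert hp, Finset.erase_insert hp, eps_insert_self hG,
    Finset.sum_eq_zero, add_zero]
  · simp [eq_comm]
  · intro j hj
    rw [if_neg]
    rintro rfl
    simp [(hG j hj).ne] at hH

theorem incidence_insert_insert {p : ℤ} {H G : Finset ℤ} (hH : p ∉ H) (hG : ∀ v ∈ G, p < v) :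
    incidence L (insert p H) (insert p G) = -incidence L H G := by
  have hp : p ∉ G := fun hp => (hG p hp).false
  rw [incidence, Finset.sum_insert hp, Finset.erase_insert hp, if_neg, zero_add, incidence,
    ← Finset.sum_neg_distrib]
  · refine Finset.sum_congr rfl fun j hj => ?_
    rw [Finset.erase_insert_of_ne (hG j hj).ne, eps_insert_of_mem hG hj]
    have : insert p (G.erase j) = insert p H ↔ G.erase j = H := by
      constructor
      · intro h
        rw [← Finset.erase_insert (fun h' => hp (Finset.mem_of_mem_erase h') : p ∉ G.erase j), h,
          Finset.erase_insert hH]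
      · rintro rfl; rfl
    by_cases h : G.erase j = H <;> simp [this, h]
  · rintro rfl
    simp at hp

theorem incidence_insert_left {p : ℤ} {H F : Finset ℤ} (hF : p ∉ F) :
    incidence L (insert p H) F = 0 := by
  by_contra h
  obtain ⟨j, -, hj⟩ := exists_of_incidence_ne_zero h
  exact hF (Finset.mem_of_mem_erase (hj ▸ Finset.mem_insert_self p H : p ∈ F.erase j))

/-- This is ∂∂ = 0, by induction on the least vertex p: from ∂(pG) = G - p∂G follows ∂∂(pG) = ∂G -
∂G + p∂∂G. -/
theorem sum_incidence_mul_incidence (V H F : Finset ℤ) (hH : H ⊆ V) (hF : F ⊆ V) :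
    ∑ G ∈ V.powerset, incidence L H G * incidence L G F = 0 := by
  induction V using Finset.induction_on_min generalizing H F with
  | empty => simp [incidence, Finset.subset_empty.1 hF]
  | insert p V hV ih =>
    have hp : p ∉ V := fun hp => (hV p hp).false
    have sub {A : Finset ℤ} (hA : A ⊆ V) : ∀ v ∈ A, p < v := fun v hv => hV v (hA hv)
    have nsub {A : Finset ℤ} (hA : A ⊆ V) : p ∉ A := fun h => hp (hA h)
    have split {A : Finset ℤ} (hA : A ⊆ insert p V) : A ⊆ V ∨ ∃ B ⊆ V, A = insert p B := by
      by_cases h : p ∈ A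
      · exact .inr ⟨A.erase p, Finset.subset_insert_iff.1 hA, (Finset.insert_erase h).symm⟩
      · exact .inl ((Finset.subset_insert_iff_of_notMem h).1 hA)
    rw [Finset.sum_powerset_insert hp]
    rcases split hF with hF' | ⟨F, hF', rfl⟩
    · rw [Finset.sum_eq_zero (s := V.powerset) (f := fun t => _ * incidence L (insert p t) F)
        fun t ht => by rw [incidence_insert_left (nsub hF'), mul_zero], add_zero]
      rcases split hH with hH' | ⟨H, hH', rfl⟩
      · exact ih H F hH' hF'
      · exact Finset.sum_eq_zero fun t ht => by
          rw [incidence_insert_left (nsub (Finset.mem_powerset.1 ht)), zero_mul]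
    · rw [Finset.sum_congr rfl fun t ht => by
          rw [incidence_insert_right (nsub (Finset.mem_powerset.1 ht)) (sub hF')],
        Finset.sum_congr (s₁ := V.powerset) (f := fun t => _ * incidence L (insert p t) _) rfl
          fun t ht => by
          rw [incidence_insert_insert (nsub (Finset.mem_powerset.1 ht)) (sub hF')]]
      simp only [mul_ite, mul_one, mul_zero, Finset.sum_ite_eq', Finset.mem_powerset, hF', if_true]
      rcases split hH with hH' | ⟨H, hH', rfl⟩
      · rw [Finset.sum_congr rfl fun t ht => by
          rw [incidence_insert_right (nsub hH') (sub (Finset.mem_powerset.1 ht))]]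
        simp [hH']
      · rw [Finset.sum_congr rfl fun t ht => by
          rw [incidence_insert_insert (nsub hH') (sub (Finset.mem_powerset.1 ht)), neg_mul_neg],
          ih H F hH' hF', incidence_insert_left (nsub hF'), add_zero]

/-- The weighted incidence numbers. -/
noncomputable def wInc (w : ℕ → ℤ → L) (G F : Finset ℤ) : L :=
  incidence L G F * (weight w F.val / weight (up w) G.val)

/-- Coning with p raises the position of every element of G, which the raised denominator cancels;
only the weight of p remains. -/
theorem wInc_insert_right {w : ℕ → ℤ → L} (hw : ∀ k v, w k v ≠ 0) {p : ℤ} {H G : Finset ℤ}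
    (hH : p ∉ H) (hG : ∀ v ∈ G, p < v) :
    wInc w H (insert p G) = if H = G then w 0 p else 0 := by
  rw [wInc, incidence_insert_right hH hG, weight_insert w hG]
  split_ifs with h
  · subst h
    have := weight_ne_zero (up_ne_zero hw) H.val
    field_simp
  · simp

theorem wInc_insert_insert {w : ℕ → ℤ → L} {p : ℤ} {H G : Finset ℤ}
    (hH : ∀ v ∈ H, p < v) (hG : ∀ v ∈ G, p < v) :
    wInc w (insert p H) (insert p G) = -(w 0 p / w 1 p) * wInc (up w) H G := by
  have hp : p ∉ H := fun hp => (hH p hp).false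
  rw [wInc, incidence_insert_insert hp hG, weight_insert w hG, weight_insert _ hH, wInc,
    mul_div_mul_comm]
  simp only [up]
  ring

theorem wInc_insert_left (w : ℕ → ℤ → L) {p : ℤ} {H F : Finset ℤ} (hF : p ∉ F) :
    wInc w (insert p H) F = 0 := by
  rw [wInc, incidence_insert_left hF, zero_mul]

/-- The weight of the intermediate face G cancels between the two factors, leaving the unweighted ∂∂
= 0. -/
theorem sum_wInc_up_mul_wInc {w : ℕ → ℤ → L} (hw : ∀ k v, w k v ≠ 0) {V H F : Finset ℤ}
    (hH : H ⊆ V) (hF : F ⊆ V) :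
    ∑ G ∈ V.powerset, wInc (up w) H G * wInc w G F = 0 := by
  have : ∀ G ∈ V.powerset, wInc (up w) H G * wInc w G F =
      weight w F.val / weight (up (up w)) H.val * (incidence L H G * incidence L G F) := by
    intro G _
    have := weight_ne_zero (up_ne_zero hw) G.val
    have := weight_ne_zero (up_ne_zero (up_ne_zero hw)) H.val
    rw [wInc, wInc]
    field_simp
  rw [Finset.sum_congr rfl this, ← Finset.mul_sum, sum_incidence_mul_incidence V H F hH hF,
    mul_zero]

/-- The entries of the weighted down-up Laplacian. -/
noncomputable def gramEntry (w : ℕ → ℤ → L) (V F F' : Finset ℤ) : L :=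
  ∑ G ∈ V.powerset, wInc w G F * wInc w G F'

/-- The weighted down-up Laplacian of a family of subsets of `V`. -/
noncomputable def gram (w : ℕ → ℤ → L) (V : Finset ℤ) (𝓕 : Finset (Finset ℤ)) : Matrix 𝓕 𝓕 L :=
  .of fun F F' => gramEntry w V F.1 F'.1

section

variable {w : ℕ → ℤ → L} {p : ℤ} {V F G G' F' : Finset ℤ}

/-- Ridges avoiding p give the scalar part; ridges through p give the rescaled entry, the two signs
cancelling. -/
theorem gramEntry_insert_insert (hw : ∀ k v, w k v ≠ 0) (hV : ∀ v ∈ V, p < v) (hG : G ⊆ V)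
    (hG' : G' ⊆ V) : gramEntry w (insert p V) (insert p G) (insert p G') =
      (w 0 p ^ 2 * if G = G' then 1 else 0) + (w 0 p / w 1 p) ^ 2 * gramEntry (up w) V G G' := by
  have hp : p ∉ V := fun hp => (hV p hp).false
  rw [gramEntry, Finset.sum_powerset_insert hp]
  congr 1
  · rw [Finset.sum_congr rfl fun t ht => by
      rw [wInc_insert_right hw (fun h => hp (Finset.mem_powerset.1 ht h)) fun v hv => hV v (hG hv),
        wInc_insert_right hw (fun h => hp (Finset.mem_powerset.1 ht h))
          fun v hv => hV v (hG' hv)]]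
    simp [hG', sq, eq_comm]
  · rw [gramEntry, Finset.mul_sum]
    refine Finset.sum_congr rfl fun t ht => ?_
    have ht := Finset.mem_powerset.1 ht
    rw [wInc_insert_insert (fun v hv => hV v (ht hv)) (fun v hv => hV v (hG hv)),
      wInc_insert_insert (fun v hv => hV v (ht hv)) (fun v hv => hV v (hG' hv))]
    ring

theorem gramEntry_insert_left (hw : ∀ k v, w k v ≠ 0) (hV : ∀ v ∈ V, p < v) (hG : G ⊆ V)
    (hF : p ∉ F) : gramEntry w (insert p V) (insert p G) F = w 0 p * wInc w G F := by
  have hp : p ∉ V := fun hp => (hV p hp).false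
  rw [gramEntry, Finset.sum_powerset_insert hp, Finset.sum_eq_zero (s := V.powerset)
    (f := fun t => wInc w (insert p t) _ * _) fun t ht => by
    rw [wInc_insert_left w hF, mul_zero], add_zero]
  rw [Finset.sum_congr rfl fun t ht => by
    rw [wInc_insert_right hw (fun h => hp (Finset.mem_powerset.1 ht h)) fun v hv => hV v (hG hv)]]
  simp [hG]

theorem gramEntry_comm : gramEntry w V F F' = gramEntry w V F' F := by
  simp only [gramEntry, mul_comm]

theorem gramEntry_of_notMem (hp : p ∉ V) (hF : p ∉ F) :
    gramEntry w (insert p V) F F' = gramEntry w V F F' := by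
  rw [gramEntry, Finset.sum_powerset_insert hp, Finset.sum_eq_zero (s := V.powerset)
    (f := fun t => wInc w (insert p t) _ * _) fun t ht => by
    rw [wInc_insert_left w hF, zero_mul], add_zero, gramEntry]

end

end Weights

/-! ### Shifted families and the recursion for critical pairs -/

section Families

/-- A family of subsets of `V` that is closed under replacing elements by smaller ones. -/
structure IsShiftedFamily (V : Finset ℤ) (𝓕 : Finset (Finset ℤ)) : Prop where
  subset : ∀ F ∈ 𝓕, F ⊆ V
  shift : ∀ a ∈ V, ∀ b ∈ V, a < b → ∀ F ∈ 𝓕, a ∉ F → b ∈ F → insert a (F.erase b) ∈ 𝓕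

/-- The link of a vertex. -/
def link (p : ℤ) (𝓕 : Finset (Finset ℤ)) : Finset (Finset ℤ) :=
  (𝓕.filter (p ∈ ·)).image (·.erase p)

/-- The deletion of a vertex. -/
def deletion (p : ℤ) (𝓕 : Finset (Finset ℤ)) : Finset (Finset ℤ) :=
  𝓕.filter (p ∉ ·)

/-- The elements of `A` that can be raised by one so that the result is not in `𝓕`. -/
def raisable (𝓕 : Finset (Finset ℤ)) (A : Finset ℤ) : Finset ℤ :=
  A.filter fun a => a + 1 ∉ A ∧ insert (a + 1) (A.erase a) ∉ 𝓕

/-- The pairs `({v ∈ A | v < a}, a)` for the critical pairs of `𝓕`, where `a` is the element of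
`A ∈ 𝓕` that is raised. -/
def critSigs (𝓕 : Finset (Finset ℤ)) : Multiset (Finset ℤ × ℤ) :=
  ∑ A ∈ 𝓕, (raisable 𝓕 A).val.map fun a => (A.filter (· < a), a)

/-- The number of critical pairs in which the vertex `p` is raised. -/
def numRaised (p : ℤ) (𝓕 : Finset (Finset ℤ)) : ℕ :=
  ((link p 𝓕).filter fun G => p + 1 ∉ G ∧ insert (p + 1) G ∉ 𝓕).card

variable {p q : ℤ} {V F G : Finset ℤ} {𝓕 : Finset (Finset ℤ)}

theorem mem_link : G ∈ link p 𝓕 ↔ p ∉ G ∧ insert p G ∈ 𝓕 := by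
  simp only [link, Finset.mem_image, Finset.mem_filter]
  constructor
  · rintro ⟨F, ⟨hF, hp⟩, rfl⟩
    exact ⟨Finset.notMem_erase p F, by rwa [Finset.insert_erase hp]⟩
  · rintro ⟨hp, hG⟩
    exact ⟨_, ⟨hG, Finset.mem_insert_self p G⟩, Finset.erase_insert hp⟩

theorem mem_deletion : F ∈ deletion p 𝓕 ↔ F ∈ 𝓕 ∧ p ∉ F := Finset.mem_filter

theorem image_insert_link : (link p 𝓕).image (insert p) = 𝓕.filter (p ∈ ·) := by
  ext F
  simp only [Finset.mem_image, mem_link, Finset.mem_filter]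
  constructor
  · rintro ⟨G, ⟨-, hG⟩, rfl⟩
    exact ⟨hG, Finset.mem_insert_self p G⟩
  · rintro ⟨hF, hp⟩
    exact ⟨F.erase p, ⟨Finset.notMem_erase p F, by rwa [Finset.insert_erase hp]⟩,
      Finset.insert_erase hp⟩

theorem insert_injOn_link : Set.InjOn (insert p) (link p 𝓕 : Set (Finset ℤ)) := by
  intro G hG G' hG' h
  rw [← Finset.erase_insert (mem_link.1 hG).1, h, Finset.erase_insert (mem_link.1 hG').1]

theorem sum_eq_link_add_deletion {M : Type*} [AddCommMonoid M] (g : Finset ℤ → M) :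
    ∑ F ∈ 𝓕, g F = ∑ G ∈ link p 𝓕, g (insert p G) + ∑ F ∈ deletion p 𝓕, g F := by
  rw [← Finset.sum_filter_add_sum_filter_not 𝓕 (p ∈ ·), ← image_insert_link,
    Finset.sum_image insert_injOn_link, deletion]

theorem card_link : (link p 𝓕).card = (𝓕.filter (p ∈ ·)).card := by
  rw [← image_insert_link, Finset.card_image_of_injOn insert_injOn_link]

theorem IsShiftedFamily.link (hV : ∀ v ∈ V, p < v) (h : IsShiftedFamily (insert p V) 𝓕) :
    IsShiftedFamily V (link p 𝓕) where
  subset G hG := (Finset.subset_insert_iff_of_notMem (mem_link.1 hG).1).1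
    ((Finset.subset_insert p G).trans (h.subset _ (mem_link.1 hG).2))
  shift a ha b hb hab G hG haG hbG := by
    obtain ⟨hp, hG⟩ := mem_link.1 hG
    have := h.shift a (by simp [ha]) b (by simp [hb]) hab _ hG (by simp [haG, (hV a ha).ne'])
      (by simp [hbG])
    rw [Finset.erase_insert_of_ne (hV b hb).ne, Finset.insert_comm] at this
    exact mem_link.2 ⟨by simp [(hV a ha).ne, hp], this⟩

theorem IsShiftedFamily.deletion (hV : ∀ v ∈ V, p < v) (h : IsShiftedFamily (insert p V) 𝓕) :
    IsShiftedFamily V (deletion p 𝓕) where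
  subset F hF := (Finset.subset_insert_iff_of_notMem (mem_deletion.1 hF).2).1
    (h.subset _ (mem_deletion.1 hF).1)
  shift a ha b hb hab F hF haF hbF := by
    obtain ⟨hF, hp⟩ := mem_deletion.1 hF
    exact mem_deletion.2 ⟨h.shift a (by simp [ha]) b (by simp [hb]) hab F hF haF hbF,
      by simp [(hV a ha).ne, hp]⟩

/-- Shifting j to p keeps the face in 𝓕. Hence the link already contains all ridges of the deletion.
-/
theorem IsShiftedFamily.erase_mem_link (hV : ∀ v ∈ V, p < v)
    (h : IsShiftedFamily (insert p V) 𝓕) (hF : F ∈ ShiftedSpectrum.deletion p 𝓕) {j : ℤ}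
    (hj : j ∈ F) : F.erase j ∈ ShiftedSpectrum.link p 𝓕 := by
  have hjV := (h.deletion hV).subset F hF hj
  obtain ⟨hF, hp⟩ := mem_deletion.1 hF
  exact mem_link.2 ⟨fun h => hp (Finset.mem_of_mem_erase h),
    h.shift p (by simp) j (by simp [hjV]) (hV j hjV) F hF hp hj⟩

theorem raisable_deletion (hF : F ∈ deletion p 𝓕) (h : ∀ v ∈ F, p < v) :
    raisable 𝓕 F = raisable (deletion p 𝓕) F := by
  refine Finset.filter_congr fun a ha => ?_
  have hp : p ∉ insert (a + 1) (F.erase a) := by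
    simp [(mem_deletion.1 hF).2, ((h a ha).trans (lt_add_one a)).ne]
  simp [mem_deletion, hp]

theorem raisable_insert (h : ∀ v ∈ G, p < v) :
    raisable 𝓕 (insert p G) =
      if p + 1 ∉ G ∧ insert (p + 1) G ∉ 𝓕 then insert p (raisable (link p 𝓕) G)
      else raisable (link p 𝓕) G := by
  have hp : p ∉ G := fun hp => (h p hp).false
  have h1 : G.filter (fun a => a + 1 ∉ insert p G ∧
      insert (a + 1) ((insert p G).erase a) ∉ 𝓕) = raisable (link p 𝓕) G := by
    refine Finset.filter_congr fun a ha => ?_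
    have hpa : p ≠ a + 1 := ((h a ha).trans (lt_add_one a)).ne
    rw [mem_link, Finset.erase_insert_of_ne (h a ha).ne, Finset.insert_comm]
    simp [hpa, hpa.symm, hp]
  rw [raisable, Finset.filter_insert, h1, Finset.erase_insert hp]
  simp

/-- A critical pair either raises p itself, or raises a larger element; in the latter case p is a
mere spectator and the pair comes from the link or the deletion. -/
theorem critSigs_eq (h𝓕 : ∀ F ∈ 𝓕, ∀ v ∈ F, p ≤ v) :
    critSigs 𝓕 = (critSigs (link p 𝓕)).map (fun s => (insert p s.1, s.2)) +
      critSigs (deletion p 𝓕) + .replicate (numRaised p 𝓕) (∅, p) := by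
  have hdel : ∀ F ∈ deletion p 𝓕, ∀ v ∈ F, p < v := fun F hF v hv =>
    (h𝓕 F (mem_deletion.1 hF).1 v hv).lt_of_ne fun e => (mem_deletion.1 hF).2 (e ▸ hv)
  have hlink : ∀ G ∈ link p 𝓕, ∀ v ∈ G, p < v := fun G hG v hv =>
    (h𝓕 _ (mem_link.1 hG).2 v (by simp [hv])).lt_of_ne fun e => (mem_link.1 hG).1 (e ▸ hv)
  have h1 : ∀ G ∈ link p 𝓕,
      (raisable 𝓕 (insert p G)).val.map (fun a => ((insert p G).filter (· < a), a)) =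
        ((raisable (link p 𝓕) G).val.map fun a => (G.filter (· < a), a)).map
          (fun s => (insert p s.1, s.2)) +
        if p + 1 ∉ G ∧ insert (p + 1) G ∉ 𝓕 then {((∅ : Finset ℤ), p)} else 0 := by
    intro G hG
    have hp : p ∉ raisable (link p 𝓕) G := fun h =>
      (mem_link.1 hG).1 (Finset.mem_filter.1 h).1
    have h2 : (raisable (link p 𝓕) G).val.map (fun a => ((insert p G).filter (· < a), a)) =
        ((raisable (link p 𝓕) G).val.map fun a => (G.filter (· < a), a)).map
          (fun s => (insert p s.1, s.2)) := by
      rw [Multiset.map_map]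
      refine Multiset.map_congr rfl fun a ha => ?_
      simp [Finset.filter_insert, hlink G hG a (Finset.mem_filter.1 ha).1]
    have h3 : (insert p G).filter (· < p) = ∅ := by
      refine Finset.filter_eq_empty_iff.2 fun v hv => ?_
      rcases Finset.mem_insert.1 hv with rfl | hv
      · simp
      · exact (hlink G hG v hv).not_gt
    rw [raisable_insert (hlink G hG)]
    split_ifs
    · rw [Finset.insert_val_of_notMem hp, Multiset.map_cons, h2, h3, add_comm,
        Multiset.singleton_add]
    · rw [h2, add_zero]
  rw [critSigs, sum_eq_link_add_deletion (p := p), Finset.sum_congr rfl h1,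
    Finset.sum_add_distrib, ← Finset.sum_filter, Finset.sum_const, Multiset.nsmul_singleton,
    critSigs, critSigs,
    Finset.sum_congr (s₁ := deletion p 𝓕) rfl fun F hF => by
      rw [raisable_deletion hF (hdel F hF)],
    ← Multiset.coe_mapAddMonoidHom, map_sum]
  simp only [Multiset.coe_mapAddMonoidHom, numRaised]
  abel

/-- Adjoin p + 1 to G: if the result lies in 𝓕, it is a face of the deletion, and each such face
through p + 1 arises once, by `erase_mem_link`; otherwise raising p gives a critical pair. -/
theorem card_link_filter_notMem (hV : ∀ v ∈ V, p < v) (h : IsShiftedFamily (insert p V) 𝓕) :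
    ((link p 𝓕).filter (p + 1 ∉ ·)).card =
      ((deletion p 𝓕).filter (p + 1 ∈ ·)).card + numRaised p 𝓕 := by
  have h1 : (((link p 𝓕).filter (p + 1 ∉ ·)).filter fun G => insert (p + 1) G ∈ 𝓕).card =
      ((deletion p 𝓕).filter (p + 1 ∈ ·)).card := by
    refine Finset.card_bij' (fun G _ => insert (p + 1) G) (fun F _ => F.erase (p + 1)) ?_ ?_ ?_ ?_
    · intro G hG
      simp only [Finset.mem_filter, mem_link] at hG
      simp [mem_deletion, hG]
    · intro F hF
      obtain ⟨hF, hp⟩ := Finset.mem_filter.1 hF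
      simp [h.erase_mem_link hV hF hp, Finset.insert_erase hp, (mem_deletion.1 hF).1]
    · intro G hG
      simp only [Finset.mem_filter] at hG
      exact Finset.erase_insert hG.1.2
    · intro F hF
      exact Finset.insert_erase (Finset.mem_filter.1 hF).2
  rw [← h1, numRaised, ← Finset.card_filter_add_card_filter_not fun G => insert (p + 1) G ∈ 𝓕,
    ← Finset.filter_filter]

theorem mem_critSigs {s : Finset ℤ × ℤ} (hs : s ∈ critSigs 𝓕) :
    ∃ A ∈ 𝓕, s.1 ⊆ A ∧ s.2 ∈ A := by
  obtain ⟨A, hA, hs⟩ := Multiset.mem_sum.1 hs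
  obtain ⟨a, ha, rfl⟩ := Multiset.mem_map.1 hs
  exact ⟨A, hA, Finset.filter_subset _ _, (Finset.mem_filter.1 ha).1⟩

theorem critSigs_eq_zero (h : ∀ F ∈ 𝓕, F = ∅) : critSigs 𝓕 = 0 :=
  Multiset.eq_zero_of_forall_notMem fun s hs => by
    obtain ⟨A, hA, -, hs⟩ := mem_critSigs hs
    simp [h A hA] at hs

theorem Icc_left_induction {q : ℤ} {P : ℤ → Prop} (base : ∀ p, q < p → P p)
    (step : ∀ p ≤ q, P (p + 1) → P p) (p : ℤ) : P p := by
  induction h : (q + 1 - p).toNat generalizing p with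
  | zero => exact base p (by omega)
  | succ n ih => exact step p (by omega) (ih (p + 1) (by omega))

/-- Inductively, the link contributes its faces through p + 1, while the deletion and the pairs
raising p together contribute its faces avoiding p + 1. -/
theorem card_critSigs (h : IsShiftedFamily (Finset.Icc p q) 𝓕) :
    (critSigs 𝓕).card = (𝓕.filter (p ∈ ·)).card := by
  induction p using Icc_left_induction (q := q) generalizing 𝓕 with
  | base p hp =>
    have h0 : ∀ F ∈ 𝓕, F = ∅ := fun F hF => by simpa [hp] using h.subset F hF
    rw [critSigs_eq_zero h0, Finset.filter_false_of_mem fun F hF => by simp [h0 F hF]]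
    simp
  | step p hp ih =>
    have hle : ∀ F ∈ 𝓕, ∀ v ∈ F, p ≤ v := fun F hF v hv =>
      (Finset.mem_Icc.1 (h.subset F hF hv)).1
    have hV : ∀ v ∈ Finset.Icc (p + 1) q, p < v := fun v hv => by simp at hv; omega
    rw [← Finset.insert_Icc_add_one_left_eq_Icc hp] at h
    rw [critSigs_eq hle, Multiset.card_add, Multiset.card_add, Multiset.card_map,
      Multiset.card_replicate, ih (h.link hV), ih (h.deletion hV), add_assoc,
      ← card_link_filter_notMem hV h, Finset.card_filter_add_card_filter_not, card_link]

end Families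

/-! ### Spectrum of the down-up Laplacian of a shifted family -/

section Spectrum

open Polynomial Matrix

variable {L : Type*} [Field L] {w : ℕ → ℤ → L} {p q : ℤ} {V : Finset ℤ}
  {𝓕 : Finset (Finset ℤ)}

/-- A family splits into the cone over the link of a vertex and the deletion of the vertex. -/
noncomputable def linkSumDeletionEquiv (p : ℤ) (𝓕 : Finset (Finset ℤ)) :
    link p 𝓕 ⊕ deletion p 𝓕 ≃ 𝓕 :=
  Equiv.ofBijective
    (Sum.elim (fun G => ⟨insert p G.1, (mem_link.1 G.2).2⟩)
      fun F => ⟨F.1, (mem_deletion.1 F.2).1⟩) <| by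
    constructor
    · refine Function.Injective.sumElim ?_ ?_ ?_
      · intro G G' h
        exact Subtype.ext (insert_injOn_link G.2 G'.2 (congrArg Subtype.val h))
      · intro F F' h
        exact Subtype.ext (congrArg (fun A : 𝓕 => A.1) h)
      · intro G F h
        exact (mem_deletion.1 F.2).2 (congrArg Subtype.val h ▸ Finset.mem_insert_self p G.1)
    · intro F
      by_cases hp : p ∈ F.1
      · exact ⟨.inl ⟨F.1.erase p, mem_link.2 ⟨Finset.notMem_erase p _, by
          rw [Finset.insert_erase hp]; exact F.2⟩⟩, Subtype.ext (Finset.insert_erase hp)⟩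
      · exact ⟨.inr ⟨F.1, mem_deletion.2 ⟨F.2, hp⟩⟩, rfl⟩

/-- The weighted incidence matrix between the link and the deletion of a vertex. -/
noncomputable def linkDeletion (w : ℕ → ℤ → L) (p : ℤ) (𝓕 : Finset (Finset ℤ)) :
    Matrix (link p 𝓕) (deletion p 𝓕) L :=
  .of fun G F => wInc w G.1 F.1

theorem wInc_eq_zero_of_notMem_link (hV : ∀ v ∈ V, p < v) (h : IsShiftedFamily (insert p V) 𝓕)
    {G F : Finset ℤ} (hF : F ∈ deletion p 𝓕) (hG : G ∉ link p 𝓕) : wInc w G F = 0 := by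
  rw [wInc]
  convert zero_mul _
  by_contra hne
  obtain ⟨j, hj, rfl⟩ := exists_of_incidence_ne_zero hne
  exact hG (h.erase_mem_link hV hF hj)

/-- Matrix products over the link become sums over all subsets of V, the form in which `gramEntry`
and ∂∂ = 0 are available. -/
theorem sum_link_eq (hV : ∀ v ∈ V, p < v) (h : IsShiftedFamily (insert p V) 𝓕)
    {F : Finset ℤ} (hF : F ∈ deletion p 𝓕) (g : Finset ℤ → L) :
    ∑ G : link p 𝓕, g G.1 * wInc w G.1 F = ∑ G ∈ V.powerset, g G * wInc w G F := by
  rw [Finset.sum_coe_sort (link p 𝓕) fun G => g G * wInc w G F]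
  refine Finset.sum_subset (fun G hG => Finset.mem_powerset.2 ((h.link hV).subset G hG))
    fun G _ hG => ?_
  rw [wInc_eq_zero_of_notMem_link hV h hF hG, mul_zero]

theorem transpose_linkDeletion_mul (hV : ∀ v ∈ V, p < v) (h : IsShiftedFamily (insert p V) 𝓕) :
    (linkDeletion w p 𝓕)ᵀ * linkDeletion w p 𝓕 = gram w V (deletion p 𝓕) := by
  ext F F'
  exact sum_link_eq hV h F'.2 fun G => wInc w G F.1

theorem gram_link_mul_linkDeletion (hw : ∀ k v, w k v ≠ 0) (hV : ∀ v ∈ V, p < v)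
    (h : IsShiftedFamily (insert p V) 𝓕) :
    gram (up w) V (link p 𝓕) * linkDeletion w p 𝓕 = 0 := by
  ext G F
  refine (sum_link_eq hV h F.2 fun G' => gramEntry (up w) V G.1 G').trans ?_
  simp only [gramEntry, Finset.sum_mul, mul_assoc]
  rw [Finset.sum_comm]
  refine Finset.sum_eq_zero fun H hH => ?_
  rw [← Finset.mul_sum, sum_wInc_up_mul_wInc hw (Finset.mem_powerset.1 hH)
    ((h.deletion hV).subset _ F.2), mul_zero]

theorem gram_submatrix (hw : ∀ k v, w k v ≠ 0) (hV : ∀ v ∈ V, p < v)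
    (h : IsShiftedFamily (insert p V) 𝓕) :
    (gram w (insert p V) 𝓕).submatrix (linkSumDeletionEquiv p 𝓕) (linkSumDeletionEquiv p 𝓕) =
      fromBlocks (w 0 p ^ 2 • 1 + (w 0 p / w 1 p) ^ 2 • gram (up w) V (link p 𝓕))
        (w 0 p • linkDeletion w p 𝓕) (w 0 p • (linkDeletion w p 𝓕)ᵀ)
        ((linkDeletion w p 𝓕)ᵀ * linkDeletion w p 𝓕) := by
  rw [transpose_linkDeletion_mul hV h]
  have hp : p ∉ V := fun hp => (hV p hp).false
  have hl (G : link p 𝓕) : G.1 ⊆ V := (h.link hV).subset _ G.2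
  have hd (F : deletion p 𝓕) : p ∉ F.1 := (mem_deletion.1 F.2).2
  ext (G | F) (G' | F')
  · refine (gramEntry_insert_insert hw hV (hl G) (hl G')).trans ?_
    simp [gram, Matrix.one_apply]
  · exact gramEntry_insert_left hw hV (hl G) (hd F')
  · exact gramEntry_comm.trans (gramEntry_insert_left hw hV (hl G') (hd F))
  · exact gramEntry_of_notMem hp (hd F)

/-- The eigenvalue belonging to a critical pair. -/
noncomputable def sigEigenvalue (w : ℕ → ℤ → L) (p : ℤ) (s : Finset ℤ × ℤ) : L :=
  zWeight w s.1.val (Finset.Icc p s.2)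

theorem sigEigenvalue_eq_add (hw : ∀ k v, w k v ≠ 0) {s : Finset ℤ × ℤ}
    (h1 : ∀ v ∈ s.1, p < v) (h2 : p < s.2) :
    sigEigenvalue w p s = sigEigenvalue w (p + 1) s + w 0 p ^ 2 := by
  rw [sigEigenvalue, ← Finset.insert_Icc_add_one_left_eq_Icc h2.le,
    zWeight_insert_right hw (by simp) fun v hv => (h1 v hv).le, sigEigenvalue]

theorem sigEigenvalue_insert (hw : ∀ k v, w k v ≠ 0) {s : Finset ℤ × ℤ}
    (h1 : ∀ v ∈ s.1, p < v) (h2 : p < s.2) :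
    sigEigenvalue w p (insert p s.1, s.2) =
      (w 0 p / w 1 p) ^ 2 * sigEigenvalue (up w) (p + 1) s + w 0 p ^ 2 := by
  have hp : p ∉ s.1 := fun hp => (h1 p hp).false
  have : sigEigenvalue w p (insert p s.1, s.2) =
      (w 0 p / w 1 p) ^ 2 * sigEigenvalue (up w) p s := by
    rw [sigEigenvalue, Finset.insert_val_of_notMem hp,
      zWeight_cons_left hw (fun v hv => (Finset.mem_Icc.1 hv).1) fun v hv => (h1 v hv).le,
      sigEigenvalue]
  -- Removing p from the interval costs (w 1 p)² under raised weights, which the prefactor turns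
  -- into (w 0 p)².
  rw [this, sigEigenvalue_eq_add (up_ne_zero hw) h1 h2, show up w 0 p = w 1 p from rfl]
  have := hw 1 p
  field_simp

theorem sigEigenvalue_empty (hw : ∀ k v, w k v ≠ 0) :
    sigEigenvalue w p (∅, p) = w 0 p ^ 2 := by
  simp [sigEigenvalue, zWeight_zero_singleton hw]

/-- The characteristic polynomial of the weighted down-up Laplacian of a shifted family. -/
theorem charpoly_gram (hw : ∀ k v, w k v ≠ 0) (h : IsShiftedFamily (Finset.Icc p q) 𝓕) :
    (gram w (Finset.Icc p q) 𝓕).charpoly =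
      X ^ (𝓕.filter (p ∉ ·)).card * rootProd ((critSigs 𝓕).map (sigEigenvalue w p)) := by
  induction p using Icc_left_induction (q := q) generalizing 𝓕 w with
  | base p hp =>
    have h0 : ∀ F ∈ 𝓕, F = ∅ := fun F hF => by simpa [hp] using h.subset F hF
    have hz : gram w (Finset.Icc p q) 𝓕 = 0 := by
      ext F F'
      exact Finset.sum_eq_zero (s := (Finset.Icc p q).powerset)
        fun G _ => by simp [wInc, incidence, h0 F.1 F.2]
    rw [critSigs_eq_zero h0, Finset.filter_true_of_mem fun F hF => by simp [h0 F hF], hz,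
      charpoly_zero]
    simp [rootProd]
  | step p hp ih =>
    have hle : ∀ F ∈ 𝓕, ∀ v ∈ F, p ≤ v := fun F hF v hv =>
      (Finset.mem_Icc.1 (h.subset F hF hv)).1
    have hV : ∀ v ∈ Finset.Icc (p + 1) q, p < v := fun v hv => by simp at hv; omega
    rw [← Finset.insert_Icc_add_one_left_eq_Icc hp] at h ⊢
    have hr : (w 0 p / w 1 p) ^ 2 ≠ 0 := pow_ne_zero _ (div_ne_zero (hw 0 p) (hw 1 p))
    have hs := ih (up_ne_zero hw) (h.link hV)
    have ht := ih hw (h.deletion hV)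
    rw [← transpose_linkDeletion_mul hV h] at ht
    have hs' : ((w 0 p / w 1 p) ^ 2 • gram (up w) (Finset.Icc (p + 1) q) (link p 𝓕)).charpoly =
        X ^ ((link p 𝓕).filter (p + 1 ∉ ·)).card * rootProd
          (((critSigs (link p 𝓕)).map (sigEigenvalue (up w) (p + 1))).map
            ((w 0 p / w 1 p) ^ 2 * ·)) := by
      -- Powers of X are recorded as zero roots, which scaling leaves fixed.
      have hX (k : ℕ) : (X ^ k : L[X]) = rootProd (.replicate k 0) := by simp [rootProd]
      rw [hX, ← rootProd_add] at hs ⊢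
      rw [charpoly_smul_eq_rootProd hr hs]
      simp
    have key := charpoly_gram_fromBlocks (k := numRaised p 𝓕) (hw 0 p) _ (linkDeletion w p 𝓕)
      (by rw [Matrix.smul_mul, gram_link_mul_linkDeletion hw hV h, smul_zero]) hs' ht
      (by rw [Multiset.card_map, card_critSigs (h.deletion hV), Fintype.card_coe, add_comm,
        Finset.card_filter_add_card_filter_not])
      (by rw [Multiset.card_map, card_critSigs (h.deletion hV), card_link_filter_notMem hV h])
    rw [← charpoly_reindex (linkSumDeletionEquiv p 𝓕).symm, reindex_apply, Equiv.symm_symm,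
      gram_submatrix hw hV h, key, Fintype.card_coe, deletion]
    congr 2
    rw [critSigs_eq hle, Multiset.map_add, Multiset.map_add, Multiset.map_add,
      Multiset.map_replicate, sigEigenvalue_empty hw]
    simp only [Multiset.map_map, Function.comp_def]
    congr 2
    · refine Multiset.map_congr rfl fun s hs => ?_
      obtain ⟨A, hA, h1, h2⟩ := mem_critSigs hs
      have hA := (h.link hV).subset A hA
      exact (sigEigenvalue_insert hw (fun v hv => hV v (hA (h1 hv))) (hV _ (hA h2))).symm
    · refine Multiset.map_congr rfl fun s hs => ?_
      obtain ⟨A, hA, h1, h2⟩ := mem_critSigs hs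
      have hA := (h.deletion hV).subset A hA
      exact (sigEigenvalue_eq_add hw (fun v hv => hV v (hA (h1 hv))) (hV _ (hA h2))).symm

end Spectrum

/-! ### Long signatures in terms of raised elements -/

section CriticalPairs

theorem map_val_eq_sum_singleton {α β : Type*} (s : Finset α) (f : α → β) :
    s.val.map f = ∑ a ∈ s, {f a} := by
  rw [Finset.sum, ← Multiset.sum_map_singleton (s.val.map f), Multiset.map_map]
  rfl

theorem criticalPairs_eq_image (𝓕 : Finset (Finset ℤ)) :
    criticalPairs 𝓕 = (𝓕.sigma (raisable 𝓕)).image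
      fun s => (s.1, insert (s.2 + 1) (s.1.erase s.2)) := by
  ext ⟨A, B⟩
  simp only [criticalPairs, Set.Finite.mem_toFinset, Set.mem_ofPred_eq, IsCriticalPair, Covers,
    Finset.mem_image, Finset.mem_sigma, raisable, Finset.mem_filter, Sigma.exists, Prod.mk.injEq]
  constructor
  · rintro ⟨hA, hB, a, ha, ha', rfl⟩
    exact ⟨A, a, ⟨hA, ha, ha', hB⟩, rfl, rfl⟩
  · rintro ⟨A, a, ⟨hA, ha, ha', hB⟩, rfl, rfl⟩
    exact ⟨hA, hB, a, ha, ha', rfl⟩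

theorem sdiff_insert_erase {A : Finset ℤ} {a : ℤ} (ha : a ∈ A) :
    A \ insert (a + 1) (A.erase a) = {a} := by
  ext v
  simp only [Finset.mem_sdiff, Finset.mem_insert, Finset.mem_erase,
    Finset.mem_singleton, not_or, not_and, ne_eq]
  constructor
  · rintro ⟨hv, -, h⟩
    exact by_contra fun h' => h h' hv
  · rintro rfl
    exact ⟨ha, by omega, fun h => absurd rfl h⟩

theorem longSignatures_eq (p : ℤ) (𝓕 : Finset (Finset ℤ)) :
    longSignatures p 𝓕 = (critSigs 𝓕).map fun s => (s.1, Finset.Icc p s.2) := by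
  have hinj : Set.InjOn (fun s : Σ _ : Finset ℤ, ℤ => (s.1, insert (s.2 + 1) (s.1.erase s.2)))
      (𝓕.sigma (raisable 𝓕)) := by
    rintro ⟨A, a⟩ hs ⟨A', a'⟩ hs' h
    simp only [Finset.coe_sigma, Set.mem_sigma_iff, Finset.mem_coe, raisable,
      Finset.mem_filter] at hs hs'
    obtain ⟨rfl, h⟩ := Prod.mk.inj h
    have h1 := sdiff_insert_erase hs.2.1
    rw [h, sdiff_insert_erase hs'.2.1] at h1
    rw [Finset.singleton_injective h1]
  rw [longSignatures, map_val_eq_sum_singleton, criticalPairs_eq_image, Finset.sum_image hinj,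
    Finset.sum_sigma, critSigs, ← Multiset.coe_mapAddMonoidHom, map_sum]
  refine Finset.sum_congr rfl fun A _ => ?_
  rw [Multiset.coe_mapAddMonoidHom, Multiset.map_map, map_val_eq_sum_singleton]
  refine Finset.sum_congr rfl fun a ha => ?_
  rw [longSignature, sdiff_insert_erase (Finset.mem_filter.1 ha).1]
  simp

end CriticalPairs

/-! ### Indeterminates as weights -/

section RationalFunctions

variable (K : Type*) [Field K]

/-- The indeterminates as weights, with the first index raised by `m + 1`. -/
noncomputable def xWeight (m : ℤ) : ℕ → ℤ → RatFun K := fun k v => x K (k + 1 + m) v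

theorem up_xWeight (m : ℤ) : up (xWeight K m) = xWeight K (m + 1) := by
  ext k v
  simp only [up, xWeight]
  congr 1
  push_cast
  ring

theorem xWeight_ne_zero (m : ℤ) (k : ℕ) (v : ℤ) : xWeight K m k v ≠ 0 := by
  simp [xWeight, x]

theorem raise_zpow_x (m i j : ℤ) : (raise K ^ m) (x K i j) = x K (i + m) j := by
  have hneg (i : ℤ) : (raise K ^ (-1 : ℤ)) (x K i j) = x K (i - 1) j := by
    rw [zpow_neg_one, AlgEquiv.aut_inv, AlgEquiv.symm_apply_eq, raise_x, sub_add_cancel]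
  induction m using Int.induction_on generalizing i with
  | zero => simp
  | succ n ih =>
    rw [zpow_add, AlgEquiv.mul_apply, zpow_one, raise_x, ih]
    congr 1
    ring
  | pred n ih =>
    rw [sub_eq_add_neg, zpow_add, AlgEquiv.mul_apply, hneg, ih]
    congr 1
    ring

theorem prod_mapIdx_eq_listWeight {L : Type*} [Field L] (w : ℕ → ℤ → L) (l : List ℤ) :
    (l.mapIdx w).prod = listWeight w l := by
  induction l generalizing w with
  | nil => rfl
  | cons v l ih => 
    rw [List.mapIdx_cons, List.prod_cons, listWeight, ← ih]
    rfl

theorem raise_zpow_xMon (m : ℤ) (S : Multiset ℤ) :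
    (raise K ^ m) (xMon K S) = weight (xWeight K m) S := by
  have h : (fun (k : ℕ) (v : ℤ) => (raise K ^ m) (x K (k + 1) v)) = xWeight K m := by
    ext k v
    rw [raise_zpow_x, xWeight]
  rw [xMon, map_list_prod, weight, ← prod_mapIdx_eq_listWeight, ← h]
  congr 1
  exact List.ext_getElem (by simp) fun k _ _ => by simp

theorem raise_zpow_zPoly (m : ℤ) (S : Multiset ℤ) (T : Finset ℤ) :
    (raise K ^ m) (zPoly K S T.val) = zWeight (xWeight K m) S T := by
  have h (y : RatFun K) : (raise K ^ m) (raise K y) = (raise K ^ (m + 1)) y := by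
    rw [zpow_add, zpow_one, AlgEquiv.mul_apply]
  rw [zPoly, map_mul, map_div₀, map_one, h, XMon, map_pow, raise_zpow_xMon, zWeight, up_xWeight,
    one_div, mul_comm, div_eq_mul_inv, ← Finset.sum, map_sum]
  simp only [XMon, map_pow, raise_zpow_xMon, fun j => add_comm S {j}, Multiset.singleton_add]

/-- With all indeterminates set to 1, the numerator of z(S, T) becomes |T|, which is nonzero in
characteristic zero when T is nonempty. -/
theorem exists_algebraMap_eq_weight (m : ℤ) (S : Multiset ℤ) :
    ∃ f : MvPolynomial (ℤ × ℤ) K, algebraMap _ (RatFun K) f = weight (xWeight K m) S ∧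
      MvPolynomial.eval (fun _ => 1) f = 1 := by
  suffices h : ∀ l : List ℤ, ∀ m : ℤ, ∃ f : MvPolynomial (ℤ × ℤ) K,
      algebraMap _ (RatFun K) f = listWeight (xWeight K m) l ∧
      MvPolynomial.eval (fun _ => 1) f = 1 from h _ m
  intro l
  induction l with
  | nil => exact fun m => ⟨1, by simp [listWeight]⟩
  | cons v l ih =>
    intro m
    obtain ⟨f, hf, hf1⟩ := ih (m + 1)
    refine ⟨MvPolynomial.X ((0 : ℕ) + 1 + m, v) * f, ?_, by simp [hf1]⟩
    rw [map_mul, hf, listWeight, up_xWeight]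
    rfl

theorem zWeight_xWeight_ne_zero [CharZero K] (m : ℤ) (S : Multiset ℤ) {T : Finset ℤ}
    (hT : T.Nonempty) : zWeight (xWeight K m) S T ≠ 0 := by
  refine div_ne_zero ?_ (pow_ne_zero _ (weight_ne_zero (up_ne_zero (xWeight_ne_zero K m)) S))
  choose f hf hf1 using fun j : ℤ => exists_algebraMap_eq_weight K m (j ::ₘ S)
  simp only [← hf, ← map_pow, ← map_sum]
  rw [map_ne_zero_iff _ (IsFractionRing.injective (MvPolynomial (ℤ × ℤ) K) (RatFun K))]
  intro h
  have h1 := congrArg (MvPolynomial.eval fun _ => 1) h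
  simp [map_sum, hf1, hT.ne_empty] at h1

end RationalFunctions

/-! ### From the up-down Laplacian to the Gram matrix -/

section Laplacian

open Matrix Polynomial

variable (K : Type*) [Field K] {V : Finset ℤ} (Δ : SimplicialComplexOn V) (i : ℤ)

/-- The coboundary sums over added vertices, the incidence number over removed ones; this makes the
two matrices transposes. -/
theorem sum_sdiff_eq_incidence (L : Type*) [Field L] {G F : Finset ℤ} (hF : F ⊆ V) :
    ∑ j ∈ V \ G, (if insert j G = F then (eps j F : L) else 0) = incidence L G F := by
  rw [incidence, ← Finset.sum_filter, ← Finset.sum_filter]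
  refine Finset.sum_congr ?_ fun _ _ => rfl
  ext j
  simp only [Finset.mem_filter, Finset.mem_sdiff]
  constructor
  · rintro ⟨⟨-, hj⟩, rfl⟩
    exact ⟨Finset.mem_insert_self j G, Finset.erase_insert hj⟩
  · rintro ⟨hj, rfl⟩
    exact ⟨⟨hF hj, Finset.notMem_erase j F⟩, Finset.insert_erase hj⟩

theorem toMatrix_boundary (F : {F // F ∈ Δ.facesOfDim (i + 1)}) (G : {G // G ∈ Δ.facesOfDim i}) :
    LinearMap.toMatrix Finsupp.basisSingleOne Finsupp.basisSingleOne (boundary K Δ i) G F =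
      wInc (xWeight K (Δ.dim - (i + 1))) G.1 F.1 := by
  rw [LinearMap.toMatrix_apply, Finsupp.basisSingleOne_repr, Finsupp.coe_basisSingleOne,
    LinearEquiv.refl_apply, boundary, Finsupp.linearCombination_single, one_smul,
    Finsupp.finsetSum_apply, wInc, incidence, Finset.sum_mul, ← Finset.sum_attach F.1]
  refine Finset.sum_congr rfl fun j _ => ?_
  rw [Finsupp.single_apply, raise_zpow_xMon, raise_zpow_xMon, up_xWeight]
  by_cases h : F.1.erase j.1 = G.1
  · rw [if_pos (Subtype.ext h), if_pos h, h]
  · rw [if_neg fun e => h (congrArg Subtype.val e), if_neg h, zero_mul]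

theorem toMatrix_coboundary (F : {F // F ∈ Δ.facesOfDim (i + 1)})
    (G : {G // G ∈ Δ.facesOfDim i}) :
    LinearMap.toMatrix Finsupp.basisSingleOne Finsupp.basisSingleOne (coboundary K Δ i) F G =
      wInc (xWeight K (Δ.dim - (i + 1))) G.1 F.1 := by
  have hF : F.1 ⊆ V := Δ.subset_vertices _ (SimplicialComplexOn.mem_facesOfDim.1 F.2).1
  rw [LinearMap.toMatrix_apply, Finsupp.basisSingleOne_repr, Finsupp.coe_basisSingleOne,
    LinearEquiv.refl_apply, coboundary, Finsupp.linearCombination_single, one_smul,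
    Finsupp.finsetSum_apply, wInc, ← sum_sdiff_eq_incidence _ hF, Finset.sum_mul]
  refine Finset.sum_congr rfl fun j _ => ?_
  by_cases h : insert j G.1 = F.1
  · have h' : insert j G.1 ∈ Δ.facesOfDim (i + 1) := h ▸ F.2
    rw [dif_pos h', Finsupp.single_apply, if_pos (Subtype.ext h), if_pos h, raise_zpow_xMon,
      raise_zpow_xMon, up_xWeight, h, sub_sub, ← sub_sub (Δ.dim), sub_add_cancel]
  · rw [if_neg h, zero_mul]
    split_ifs with h'
    · rw [Finsupp.single_apply, if_neg fun e => h (congrArg Subtype.val e)]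
    · rfl

/-- A Aᵀ and Aᵀ A have the same characteristic polynomial up to powers of X. -/
theorem X_pow_mul_charpoly_upDownLaplacian :
    X ^ (Δ.facesOfDim (i + 1)).card * (upDownLaplacian K Δ i).charpoly =
      X ^ (Δ.facesOfDim i).card *
        (gram (xWeight K (Δ.dim - (i + 1))) V (Δ.facesOfDim (i + 1))).charpoly := by
  classical
  set A := LinearMap.toMatrix Finsupp.basisSingleOne Finsupp.basisSingleOne (boundary K Δ i)
    with hA
  have hAt : LinearMap.toMatrix Finsupp.basisSingleOne Finsupp.basisSingleOne
      (coboundary K Δ i) = Aᵀ := by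
    ext F G
    rw [toMatrix_coboundary, transpose_apply, hA, toMatrix_boundary]
  have hgram : Aᵀ * A = gram (xWeight K (Δ.dim - (i + 1))) V (Δ.facesOfDim (i + 1)) := by
    ext F F'
    simp only [mul_apply, transpose_apply, hA, toMatrix_boundary]
    rw [Finset.sum_coe_sort (Δ.facesOfDim i) fun G =>
      wInc (xWeight K (Δ.dim - (i + 1))) G F.1 * wInc (xWeight K (Δ.dim - (i + 1))) G F'.1]
    refine Finset.sum_subset (fun G hG => Finset.mem_powerset.2 (Δ.subset_vertices _
      (SimplicialComplexOn.mem_facesOfDim.1 hG).1)) fun G _ hG => ?_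
    rw [wInc, show incidence (RatFun K) G F.1 = 0 from ?_, zero_mul, zero_mul]
    by_contra hne
    obtain ⟨j, hj, rfl⟩ := exists_of_incidence_ne_zero hne
    exact hG (SimplicialComplexOn.erase_mem_facesOfDim F.2 hj)
  rw [← LinearMap.charpoly_toMatrix _ (Finsupp.basisSingleOne (R := RatFun K)
    (ι := {F // F ∈ Δ.facesOfDim i})), upDownLaplacian,
    LinearMap.toMatrix_comp _ Finsupp.basisSingleOne, hAt, ← hA, ← hgram]
  simpa using charpoly_mul_comm' A Aᵀ

theorem splits_and_filter_roots {L : Type*} [Field L] [DecidableEq L] {f : L[X]} {s : Multiset L}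
    {a b : ℕ} (hf : X ^ a * f = X ^ b * rootProd s) (hs : (0 : L) ∉ s) :
    f.Splits ∧ f.roots.filter (· ≠ 0) = s := by
  have h0 : X ^ b * rootProd s ≠ 0 :=
    mul_ne_zero (pow_ne_zero _ X_ne_zero) (monic_multiset_prod_of_monic _ _ fun a _ =>
      monic_X_sub_C a).ne_zero
  constructor
  · refine Splits.of_dvd ((Splits.X_pow b).mul (Splits.multisetProd (m := s.map _) ?_)) h0
      ⟨X ^ a, by rw [mul_comm f, hf, rootProd]⟩
    intro g hg
    obtain ⟨c, -, rfl⟩ := Multiset.mem_map.1 hg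
    exact Splits.X_sub_C c
  · have h := congrArg (fun g => g.roots.filter (· ≠ 0)) hf
    have hX (k : ℕ) : ((X ^ k : L[X]).roots).filter (· ≠ 0) = 0 := by
      rw [roots_X_pow, Multiset.filter_nsmul, Multiset.filter_singleton]
      simp
    rwa [roots_mul h0, roots_mul (hf ▸ h0), Multiset.filter_add, Multiset.filter_add, hX, hX,
      zero_add, zero_add, rootProd, roots_multiset_prod_X_sub_C,
      Multiset.filter_eq_self.2 fun c hc => ne_of_mem_of_not_mem hc hs] at h

end Laplacian

theorem isShiftedFamily_facesOfDim {V : Finset ℤ} {Δ : SimplicialComplexOn V} (h : Δ.IsShifted)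
    (i : ℤ) : IsShiftedFamily V (Δ.facesOfDim i) where
  subset F hF := Δ.subset_vertices F (SimplicialComplexOn.mem_facesOfDim.1 hF).1
  shift a ha b hb hab F hF haF hbF := by
    rw [SimplicialComplexOn.mem_facesOfDim] at hF ⊢
    refine ⟨h a ha b hb hab F hF.1 haF hbF, ?_⟩
    rw [Finset.card_insert_of_notMem fun h => haF (Finset.mem_of_mem_erase h),
      Finset.card_erase_add_one hbF, hF.2]

end ShiftedSpectrum

open ShiftedSpectrum in
theorem theorem1p5 {K : Type*} [Field K] [CharZero K] (p q : ℤ)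
    (Sig : ShiftedSpectrum.SimplicialComplexOn (Finset.Icc p q)) (hSig : Sig.IsShifted)
    (d : ℕ) (hd : Sig.dim = d) (i : ℕ) (hi : i ≤ d) :
    (ShiftedSpectrum.upDownLaplacian K Sig ((i : ℤ) - 1)).charpoly.Splits ∧
    ShiftedSpectrum.nonzeroEigenvalues (ShiftedSpectrum.upDownLaplacian K Sig ((i : ℤ) - 1)) =
      (ShiftedSpectrum.longSignatures p (Sig.facesOfDim i)).map fun ST =>
        (ShiftedSpectrum.raise K ^ ((d : ℤ) - i)) (ShiftedSpectrum.zPoly K ST.1.val ST.2.val) := by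
  classical
  have hsh := isShiftedFamily_facesOfDim hSig ((i : ℤ) - 1 + 1)
  have h := X_pow_mul_charpoly_upDownLaplacian K Sig ((i : ℤ) - 1)
  rw [charpoly_gram (xWeight_ne_zero K _) hsh, ← mul_assoc, ← pow_add] at h
  simp only [sub_add_cancel, hd] at h hsh
  have hs : (critSigs (Sig.facesOfDim i)).map (sigEigenvalue (xWeight K (d - i)) p) =
      (longSignatures p (Sig.facesOfDim i)).map fun ST =>
        (raise K ^ ((d : ℤ) - i)) (zPoly K ST.1.val ST.2.val) := by
    simp only [raise_zpow_zPoly]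
    rw [longSignatures_eq, Multiset.map_map]
    rfl
  -- The interval [p, a] is nonempty, as the raised element a lies in a face, hence in [p, q].
  have h0 : (0 : RatFun K) ∉
      (critSigs (Sig.facesOfDim i)).map (sigEigenvalue (xWeight K (d - i)) p) := by
    intro h0
    obtain ⟨s, hs, h0⟩ := Multiset.mem_map.1 h0
    obtain ⟨A, hA, -, hsA⟩ := mem_critSigs hs
    exact zWeight_xWeight_ne_zero K _ _
      (Finset.nonempty_Icc.2 (Finset.mem_Icc.1 (hsh.subset A hA hsA)).1) h0
  have key := splits_and_filter_roots h h0
  refine ⟨key.1, ?_⟩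
  rw [← hs, ← key.2, nonzeroEigenvalues]
  congr!
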